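/- Let $0<p\le 1$ and let $\mathbb X$ be a $p$-Banach space over $\mathbb F=\mathbb R$ or $\mathbb C$, that is, a vector space which is complete with respect to a function $\|\cdot\|:\mathbb X\to[0,\infty)$ satisfying $\|x\|=0\iff x=0$, $\|\alpha x\|=|\alpha|\,\|x\|$ and $\|x+y\|^p\le\|x\|^p+\|y\|^p$. Let $\mathcal B=(\mathbf x_n)_{n\in\mathbb N}$ be a semi-normalized Markushevich basis of $\mathbb X$ with dual basis $(\mathbf x_n^*)_{n\in\mathbb N}\subset\mathbb X^*$; that is, $\mathbf x_n^*(\mathbf x_m)=\delta_{n,m}$ for all $n,m$, the linear span of $(\mathbf x_n)$ is dense in $\mathbb X$, the linear span of $(\mathbf x_n^*)$ is weak*-dense in $\mathbb X^*$, and there are constants $\mathbf c_1,\mathbf c_2>0$ with $\mathbf c_1\le\min\{\|\mathbf x_n\|,\|\mathbf x_n^*\|\}$ and $\max\{\|\mathbf x_n\|,\|\mathbf x_n^*\|\}\le\mathbf c_2$ for all $n$. For a finite set $A\subset\mathbb N$ and $x\in\mathbb X$ put $P_A(x)=\sum_{n\in A}\mathbf x_n^*(x)\mathbf x_n$, and call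 $A$ a greedy set of $x$ if $|\mathbf x_n^*(x)|\ge|\mathbf x_j^*(x)|$ for all $n\in A$ and $j\notin A$. Let $$\mathbb X_d=\{x\in\mathbb X:\ |\mathbf x_n^*(x)|\ne|\mathbf x_j^*(x)|\ \text{ for all } n\ne j\}.$$ Then the following are equivalent: 1. $\mathcal B$ is almost-greedy: there is $C>0$ such that $\|x-P_A(x)\|\le C\inf_{|B|\le|A|}\|x-P_B(x)\|$ for every $x\in\mathbb X$ and every finite greedy set $A$ of $x$ (the infimum being over finite sets $B\subset\mathbb N$). 2. $\mathcal B$ is almost-greedy for elements of $\mathbb X_d$: there is $C>0$ such that $\|x-P_A(x)\|\le C\inf_{|B|\le|A|}\|x-P_B(x)\|$ for every $x\in\mathbb X_d$ and every finite greedy set $A$ of $x$. 3. $\mathcal B$ is quasi-greedy and democratic: there is $C>0$ such that $\|x-P_A(x)\|\le C\|x\|$ for every $x\in\mathbb X$ and every finite greedy set $A$ of $x$; and there is $C>0$ such that $\left\|\sum_{n\in A}\mathbf x_n\right\|\le C\left\|\sum_{n\in B}\mathbf x_n\right\|$ for all finite sets $A,B\subset\mathbb N$ with $|A|\le|B|$.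 -/

import Mathlib

open scoped Uniformity

namespace GreedyBasis

/-- `X` is a `p`-Banach space over `𝕜`: its norm function is a `p`-norm, the uniform structure
(hence the topology) of `X` is the one given by this `p`-norm, and `X` is complete. -/
class PBanachSpace (𝕜 : Type*) (p : ℝ) (X : Type*) [RCLike 𝕜] [AddCommGroup X] [Module 𝕜 X]
    [Norm X] [UniformSpace X] : Prop where
  norm_nonneg : ∀ x : X, 0 ≤ ‖x‖
  norm_eq_zero_iff : ∀ x : X, ‖x‖ = 0 ↔ x = 0
  norm_smul : ∀ (a : 𝕜) (x : X), ‖a • x‖ = ‖a‖ * ‖x‖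
  norm_add_rpow_le : ∀ x y : X, ‖x + y‖ ^ p ≤ ‖x‖ ^ p + ‖y‖ ^ p
  uniformity_basis : (𝓤 X).HasBasis (fun ε : ℝ => 0 < ε) (fun ε => {q : X × X | ‖q.1 - q.2‖ < ε})
  complete : CompleteSpace X

variable {𝕜 X : Type*} [RCLike 𝕜] [AddCommGroup X] [Module 𝕜 X] [Norm X] [UniformSpace X]

/-- The norm of a continuous functional: the supremum of `‖f x‖` over the closed unit ball. -/
noncomputable def dualNorm (f : X →L[𝕜] 𝕜) : ℝ :=
  sSup {r : ℝ | ∃ x : X, ‖x‖ ≤ 1 ∧ r = ‖f x‖}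

/-- `e` is a (semi-normalized) Markushevich basis with dual basis `e'`. -/
structure IsMarkushevichBasis (e : ℕ → X) (e' : ℕ → (X →L[𝕜] 𝕜)) : Prop where
  biorthogonal : ∀ n m : ℕ, e' n (e m) = if n = m then 1 else 0
  dense_span : Dense (Submodule.span 𝕜 (Set.range e) : Set X)
  weakStar_dense_span :
    Dense (Submodule.span 𝕜 (Set.range fun n => StrongDual.toWeakDual (e' n)) : Set (WeakDual 𝕜 X))
  semi_normalized : ∃ c₁ c₂ : ℝ, 0 < c₁ ∧
    ∀ n : ℕ, c₁ ≤ min ‖e n‖ (dualNorm (e' n)) ∧ max ‖e n‖ (dualNorm (e' n)) ≤ c₂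

/-- The projection `P_A(x) = ∑_{n ∈ A} e'_n(x) e_n`. -/
def proj (e : ℕ → X) (e' : ℕ → (X →L[𝕜] 𝕜)) (A : Finset ℕ) (x : X) : X :=
  ∑ n ∈ A, e' n x • e n

/-- `A` is a (finite) greedy set of `x`. -/
def IsGreedySet (e' : ℕ → (X →L[𝕜] 𝕜)) (x : X) (A : Finset ℕ) : Prop :=
  ∀ n ∈ A, ∀ j ∉ A, ‖e' j x‖ ≤ ‖e' n x‖

/-- The almost-greedy inequality, with one constant, for all elements of the set `D`. -/
def AlmostGreedyOn (e : ℕ → X) (e' : ℕ → (X →L[𝕜] 𝕜)) (D : Set X) : Prop :=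
  ∃ C : ℝ, 0 < C ∧ ∀ x ∈ D, ∀ A : Finset ℕ, IsGreedySet e' x A →
    ‖x - proj e e' A x‖ ≤ C * ⨅ B : {B : Finset ℕ // B.card ≤ A.card}, ‖x - proj e e' B x‖

/-- Almost-greedy bases. -/
def AlmostGreedy (e : ℕ → X) (e' : ℕ → (X →L[𝕜] 𝕜)) : Prop :=
  AlmostGreedyOn e e' Set.univ

/-- The set `X_d` of the elements whose coefficients have pairwise distinct moduli. -/
def distinctModuli (e' : ℕ → (X →L[𝕜] 𝕜)) : Set X :=
  {x | ∀ n j : ℕ, n ≠ j → ‖e' n x‖ ≠ ‖e' j x‖}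

/-- Quasi-greedy bases. -/
def QuasiGreedy (e : ℕ → X) (e' : ℕ → (X →L[𝕜] 𝕜)) : Prop :=
  ∃ C : ℝ, 0 < C ∧ ∀ (x : X) (A : Finset ℕ), IsGreedySet e' x A →
    ‖x - proj e e' A x‖ ≤ C * ‖x‖

/-- Democratic bases. -/
def Democratic {X : Type*} [AddCommGroup X] [Norm X] (e : ℕ → X) : Prop :=
  ∃ C : ℝ, 0 < C ∧ ∀ A B : Finset ℕ, A.card ≤ B.card →
    ‖∑ n ∈ A, e n‖ ≤ C * ‖∑ n ∈ B, e n‖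

end GreedyBasis

open Finset

namespace GreedyBasis

/-! ### Coefficient estimates for `p`-norms, in place of convexity. -/

section PNorm

variable {𝕜 X : Type*} [RCLike 𝕜] [AddCommGroup X] [Module 𝕜 X]

/-! Everything is done with `N = ‖·‖ ^ p`, which is subadditive; convexity is not available. In its
place, sums with bounded coefficients are compared with subsums by binary expansion (`sum_smul_le`).

Write `1_E` for `∑ n ∈ E, e n`. Almost-greedy gives quasi-greedy with `B = ∅`, and democracy by
testing `1_{A ∪ B}`, for which every subset of `A ∪ B` is greedy (`democratic_bound`).

Conversely, let `A` be greedy for `x` and `y = x - P_B x`. Then `x - P_A x = (y - P_{A \ B} y) +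
P_{B \ A} x`, and `A \ B` is greedy for `y`, so quasi-greediness handles the first term. The
coefficients in the second are at most some `α` that bounds those on `A \ B` from below; by
democracy it is controlled by `α ^ p * N(1_{A \ B})`, hence by `N y` through
`exists_greedy_lower_bound`. That bound cuts a greedy set into bands of nearly equal moduli, whose
contributions decay geometrically.

To pass from `X_d` to all vectors, move `x` along a fixed `v` whose coefficients have the phases of
those of `x`: the moduli become `‖e' n x‖ + t * w n` with `w` injective and larger on `A`, so all
but countably many `t > 0` land in `X_d` and keep `A` greedy. Then let `t` be small. -/

/-- The `p`-th power `N` of a `p`-norm: nonnegative, subadditive and homogeneous of degree `p`. -/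
structure IsPNormPow (𝕜 : Type*) {X : Type*} [RCLike 𝕜] [AddCommGroup X] [Module 𝕜 X] (p : ℝ)
    (N : X → ℝ) : Prop where
  pos : 0 < p
  nonneg : ∀ x, 0 ≤ N x
  add_le : ∀ x y, N (x + y) ≤ N x + N y
  smul : ∀ (a : 𝕜) (x : X), N (a • x) = ‖a‖ ^ p * N x

namespace IsPNormPow

variable {p : ℝ} {N : X → ℝ}

theorem zero (h : IsPNormPow 𝕜 p N) : N 0 = 0 := by
  have := h.smul 0 0
  rwa [zero_smul, norm_zero, Real.zero_rpow h.pos.ne', zero_mul] at this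

theorem neg (h : IsPNormPow 𝕜 p N) (x : X) : N (-x) = N x := by
  have := h.smul (-1) x
  rwa [neg_smul, one_smul, norm_neg, norm_one, Real.one_rpow, one_mul] at this

theorem sub_le (h : IsPNormPow 𝕜 p N) (x y : X) : N (x - y) ≤ N x + N y := by
  simpa only [sub_eq_add_neg, h.neg] using h.add_le x (-y)

theorem sum_le (h : IsPNormPow 𝕜 p N) {ι : Type*} (s : Finset ι) (f : ι → X) :
    N (∑ i ∈ s, f i) ≤ ∑ i ∈ s, N (f i) :=
  le_sum_of_subadditive N h.zero.le h.add_le s f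

theorem smul_le (h : IsPNormPow 𝕜 p N) {a : 𝕜} {r : ℝ} (ha : ‖a‖ ≤ r) (x : X) :
    N (a • x) ≤ r ^ p * N x := by
  rw [h.smul]
  exact mul_le_mul_of_nonneg_right (Real.rpow_le_rpow (norm_nonneg a) ha h.pos.le) (h.nonneg x)

theorem smul_le_self (h : IsPNormPow 𝕜 p N) {a : 𝕜} (ha : ‖a‖ ≤ 1) (x : X) : N (a • x) ≤ N x := by
  simpa using h.smul_le ha x

/-- Sums with coefficients in `[0, 1]` are controlled by the sums over subsets. -/
theorem sum_unitInterval_smul_le (h : IsPNormPow 𝕜 p N) {ι : Type*} (D : Finset ι) (f : ι → X)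
    {M : ℝ} (hM : ∀ F ⊆ D, N (∑ i ∈ F, f i) ≤ M) (a : ι → ℝ) (h₀ : ∀ i, 0 ≤ a i)
    (h₁ : ∀ i, a i ≤ 1) :
    N (∑ i ∈ D, (a i : 𝕜) • f i) ≤ M / (2 ^ p - 1) := by
  classical
  have h2 : (1 : ℝ) < 2 ^ p := Real.one_lt_rpow one_lt_two h.pos
  set S : Set ℝ := {r | ∃ a : ι → ℝ, (∀ i, 0 ≤ a i) ∧ (∀ i, a i ≤ 1) ∧
    r = N (∑ i ∈ D, (a i : 𝕜) • f i)} with hS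
  have hbdd : BddAbove S := by
    refine ⟨∑ i ∈ D, N (f i), ?_⟩
    rintro _ ⟨b, hb₀, hb₁, rfl⟩
    refine (h.sum_le _ _).trans (sum_le_sum fun i _ => h.smul_le_self ?_ _)
    rw [RCLike.norm_ofReal, abs_of_nonneg (hb₀ i)]
    exact hb₁ i
  have hmem : N (∑ i ∈ D, (a i : 𝕜) • f i) ∈ S := ⟨a, h₀, h₁, rfl⟩
  -- Peel off the first binary digit: `2 * b` is a 0/1 family plus a family `c` again in `[0, 1]`.
  -- The supremum `σ` thus satisfies `2 ^ p * σ ≤ M + σ`; its finiteness allows solving for `σ`.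
  have key : ∀ r ∈ S, r ≤ (M + sSup S) / 2 ^ p := by
    rintro _ ⟨b, hb₀, hb₁, rfl⟩
    set c : ι → ℝ := fun i => 2 * b i - if 1 / 2 ≤ b i then 1 else 0 with hc
    have hcS : N (∑ i ∈ D, (c i : 𝕜) • f i) ≤ sSup S := by
      refine le_csSup hbdd ⟨c, fun i => ?_, fun i => ?_, rfl⟩
      · have := hb₀ i
        simp only [hc]; split_ifs <;> linarith
      · have := hb₁ i
        simp only [hc]; split_ifs <;> linarith
    have hsplit : (2 : 𝕜) • ∑ i ∈ D, (b i : 𝕜) • f i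
        = ∑ i ∈ D with 1 / 2 ≤ b i, f i + ∑ i ∈ D, (c i : 𝕜) • f i := by
      rw [sum_filter, smul_sum, ← sum_add_distrib]
      refine sum_congr rfl fun i _ => ?_
      simp only [hc]
      split_ifs
      · push_cast
        module
      · push_cast
        module
    have h3 : (2 : ℝ) ^ p * N (∑ i ∈ D, (b i : 𝕜) • f i) ≤ M + sSup S := by
      have := h.smul 2 (∑ i ∈ D, (b i : 𝕜) • f i)
      rw [RCLike.norm_ofNat] at this
      rw [← this, hsplit]
      exact (h.add_le _ _).trans (add_le_add (hM _ (filter_subset _ _)) hcS)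
    rw [le_div_iff₀ (by positivity), mul_comm]
    exact h3
  have hsup := csSup_le ⟨_, hmem⟩ key
  refine (le_csSup hbdd hmem).trans ?_
  rw [le_div_iff₀ (by positivity)] at hsup
  rw [le_div_iff₀ (by linarith)]
  linarith

/-- Sums with coefficients in the unit disc are controlled by the sums over subsets. -/
theorem sum_unitDisc_smul_le (h : IsPNormPow 𝕜 p N) {ι : Type*} (D : Finset ι) (f : ι → X)
    {M : ℝ} (hM : ∀ F ⊆ D, N (∑ i ∈ F, f i) ≤ M) (a : ι → 𝕜) (ha : ∀ i, ‖a i‖ ≤ 1) :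
    N (∑ i ∈ D, a i • f i) ≤ 4 / (2 ^ p - 1) * M := by
  have hpart : ∀ u : ι → ℝ, (∀ i, |u i| ≤ 1) →
      N (∑ i ∈ D, (u i : 𝕜) • f i) ≤ M / (2 ^ p - 1) + M / (2 ^ p - 1) := by
    intro u hu
    have hsplit : ∑ i ∈ D, (u i : 𝕜) • f i
        = ∑ i ∈ D, ((max (u i) 0 : ℝ) : 𝕜) • f i - ∑ i ∈ D, ((max (-u i) 0 : ℝ) : 𝕜) • f i := by
      rw [← sum_sub_distrib]
      refine sum_congr rfl fun i _ => ?_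
      rw [← sub_smul, ← RCLike.ofReal_sub]
      congr 2
      rcases le_total 0 (u i) with h' | h'
      · rw [max_eq_left h', max_eq_right (by linarith), sub_zero]
      · rw [max_eq_right h', max_eq_left (by linarith), zero_sub, neg_neg]
    rw [hsplit]
    refine (h.sub_le _ _).trans (add_le_add ?_ ?_)
    · exact h.sum_unitInterval_smul_le D f hM _ (fun i => le_max_right _ _)
        fun i => max_le (abs_le.1 (hu i)).2 zero_le_one
    · exact h.sum_unitInterval_smul_le D f hM _ (fun i => le_max_right _ _)
        fun i => max_le (by linarith [(abs_le.1 (hu i)).1]) zero_le_one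
  -- `RCLike.I` is `0` over the reals. The factor `4` counts the positive and negative parts of the
  -- real and imaginary parts.
  have hI : ‖(RCLike.I : 𝕜)‖ ≤ 1 := by
    rcases eq_or_ne (RCLike.I : 𝕜) 0 with h' | h'
    · simp [h']
    · exact (RCLike.norm_I_of_ne_zero h').le
  have hsplit : ∑ i ∈ D, a i • f i = ∑ i ∈ D, ((RCLike.re (a i) : ℝ) : 𝕜) • f i
      + (RCLike.I : 𝕜) • ∑ i ∈ D, ((RCLike.im (a i) : ℝ) : 𝕜) • f i := by
    rw [smul_sum, ← sum_add_distrib]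
    refine sum_congr rfl fun i _ => ?_
    rw [smul_smul, ← add_smul, mul_comm RCLike.I, RCLike.re_add_im]
  have hre := hpart (fun i => RCLike.re (a i)) fun i => (RCLike.abs_re_le_norm _).trans (ha i)
  have him := hpart (fun i => RCLike.im (a i)) fun i => (RCLike.abs_im_le_norm _).trans (ha i)
  calc N (∑ i ∈ D, a i • f i) ≤ _ := hsplit ▸ h.add_le _ _
    _ ≤ (M / (2 ^ p - 1) + M / (2 ^ p - 1)) + (M / (2 ^ p - 1) + M / (2 ^ p - 1)) :=
      add_le_add hre ((h.smul_le_self hI _).trans him)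
    _ = 4 / (2 ^ p - 1) * M := by ring

/-- Sums with coefficients bounded by `α` are controlled by the sums over subsets. -/
theorem sum_smul_le (h : IsPNormPow 𝕜 p N) {ι : Type*} (D : Finset ι) (f : ι → X)
    {M : ℝ} (hM : ∀ F ⊆ D, N (∑ i ∈ F, f i) ≤ M) (a : ι → 𝕜) {α : ℝ} (hα : 0 ≤ α)
    (ha : ∀ i ∈ D, ‖a i‖ ≤ α) :
    N (∑ i ∈ D, a i • f i) ≤ α ^ p * (4 / (2 ^ p - 1) * M) := by
  classical
  set c : ι → 𝕜 := fun i => if i ∈ D then a i / (α : 𝕜) else 0 with hc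
  have hsum : ∑ i ∈ D, a i • f i = (α : 𝕜) • ∑ i ∈ D, c i • f i := by
    rw [smul_sum]
    refine sum_congr rfl fun i hi => ?_
    rw [smul_smul]
    congr 1
    simp only [hc, if_pos hi]
    rcases hα.eq_or_lt with h' | h'
    · have := ha i hi
      rw [← h'] at this
      simp [norm_le_zero_iff.1 this]
    · have : (α : 𝕜) ≠ 0 := RCLike.ofReal_ne_zero.2 h'.ne'
      field_simp
  rw [hsum, h.smul, RCLike.norm_ofReal, abs_of_nonneg hα]
  refine mul_le_mul_of_nonneg_left (h.sum_unitDisc_smul_le D f hM c fun i => ?_)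
    (Real.rpow_nonneg hα p)
  simp only [hc]
  split_ifs with hi
  · rw [norm_div, RCLike.norm_ofReal, abs_of_nonneg hα]
    exact div_le_one_of_le₀ (ha i hi) hα
  · simp

end IsPNormPow

end PNorm

/-- Polar decomposition of a scalar. -/
theorem exists_norm_one_eq_norm_mul {𝕜 : Type*} [RCLike 𝕜] (z : 𝕜) :
    ∃ s : 𝕜, ‖s‖ = 1 ∧ z = (‖z‖ : 𝕜) * s := by
  rcases eq_or_ne z 0 with rfl | hz
  · exact ⟨1, by simp⟩
  · have hz' : (‖z‖ : 𝕜) ≠ 0 := RCLike.ofReal_ne_zero.2 (norm_ne_zero_iff.2 hz)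
    refine ⟨z / (‖z‖ : 𝕜), ?_, ?_⟩
    · rw [norm_div, RCLike.norm_ofReal, abs_norm, div_self (norm_ne_zero_iff.2 hz)]
    · field_simp

/-! ### Greedy projections, lower estimates and democracy. -/

section Basis

variable {𝕜 X : Type*} [RCLike 𝕜] [AddCommGroup X] [Module 𝕜 X] [UniformSpace X]
  {e : ℕ → X} {e' : ℕ → (X →L[𝕜] 𝕜)} {p : ℝ} {N : X → ℝ}

theorem coeff_sum (hb : ∀ n m : ℕ, e' n (e m) = if n = m then 1 else 0) (E : Finset ℕ) (c : ℕ → 𝕜)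
    (j : ℕ) : e' j (∑ n ∈ E, c n • e n) = if j ∈ E then c j else 0 := by
  simp [map_sum, hb]

theorem proj_sum (hb : ∀ n m : ℕ, e' n (e m) = if n = m then 1 else 0) (E F : Finset ℕ)
    (c : ℕ → 𝕜) : proj e e' F (∑ n ∈ E, c n • e n) = ∑ n ∈ F ∩ E, c n • e n := by
  simp only [proj, coeff_sum hb, ite_smul, zero_smul, sum_ite_mem]

theorem coeff_proj (hb : ∀ n m : ℕ, e' n (e m) = if n = m then 1 else 0) (E : Finset ℕ) (x : X)
    (j : ℕ) : e' j (proj e e' E x) = if j ∈ E then e' j x else 0 :=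
  coeff_sum hb E (fun n => e' n x) j

theorem proj_add (e : ℕ → X) (A : Finset ℕ) (x y : X) :
    proj e e' A (x + y) = proj e e' A x + proj e e' A y := by
  simp only [proj, map_add, add_smul, sum_add_distrib]

theorem proj_smul (e : ℕ → X) (A : Finset ℕ) (a : 𝕜) (x : X) :
    proj e e' A (a • x) = a • proj e e' A x := by
  simp only [proj, map_smul, smul_eq_mul, mul_smul, smul_sum]

/-- If `N` is suppressed by `C` on greedy projections, subsums of a sum of basis vectors with
unimodular coefficients are controlled by the whole sum. -/
theorem subsum_unimodular_le (hb : ∀ n m : ℕ, e' n (e m) = if n = m then 1 else 0) {C : ℝ}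
    (hQ : ∀ x A, IsGreedySet e' x A → N (x - proj e e' A x) ≤ C * N x) {E F : Finset ℕ}
    (hF : F ⊆ E) (s : ℕ → 𝕜) (hs : ∀ n, ‖s n‖ = 1) :
    N (∑ n ∈ F, s n • e n) ≤ C * N (∑ n ∈ E, s n • e n) := by
  -- All nonzero coefficients have modulus one, so the part to be discarded is greedy.
  have hg : IsGreedySet e' (∑ n ∈ E, s n • e n) (E \ F) := by
    intro n hn j _
    rw [coeff_sum hb, coeff_sum hb, if_pos (mem_sdiff.1 hn).1, hs]
    split_ifs
    · rw [hs]
    · simp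
  have := hQ _ _ hg
  rwa [proj_sum hb, inter_eq_left.2 sdiff_subset, sub_eq_of_eq_add'
    (sum_sdiff hF (f := fun n => s n • e n)).symm] at this

/-- The lower estimate for coefficients whose moduli lie in a narrow band. -/
theorem sum_band_le (h : IsPNormPow 𝕜 p N)
    (hb : ∀ n m : ℕ, e' n (e m) = if n = m then 1 else 0) {C : ℝ} (hC : 0 ≤ C)
    (hQ : ∀ x A, IsGreedySet e' x A → N (x - proj e e' A x) ≤ C * N x) {δ : ℝ} (hδ : 0 ≤ δ)
    (hδC : δ ^ p * (4 / (2 ^ p - 1) * C) ≤ 1 / 2) (E : Finset ℕ) (c : ℕ → 𝕜) {r : ℝ} (hr : 0 < r)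
    (hc : ∀ n ∈ E, r ≤ ‖c n‖ ∧ ‖c n‖ ≤ r * (1 + δ)) :
    r ^ p * N (∑ n ∈ E, e n) ≤ 4 / (2 ^ p - 1) * (2 * C) * N (∑ n ∈ E, c n • e n) := by
  choose s hs hcs using fun n => exists_norm_one_eq_norm_mul (c n)
  have h2 : 0 < (2 : ℝ) ^ p - 1 := by linarith [Real.one_lt_rpow one_lt_two h.pos]
  set g := ∑ n ∈ E, s n • e n with hg
  have hsub : ∀ F ⊆ E, N (∑ n ∈ F, s n • e n) ≤ C * N g :=
    fun F hF => subsum_unimodular_le hb hQ hF s hs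
  -- `c n = r * (1 + u n) * s n` with `0 ≤ u n ≤ δ` on `E`: a small perturbation `v` of the flat
  -- vector `g`, absorbed because `N v ≤ N g / 2`.
  set u : ℕ → 𝕜 := fun n => (((‖c n‖ - r) / r : ℝ) : 𝕜) with hu
  set v := ∑ n ∈ E, u n • s n • e n with hv
  have hvle : N v ≤ 1 / 2 * N g := by
    have := h.sum_smul_le E (fun n => s n • e n) hsub u hδ fun n hn => by
      rw [hu, RCLike.norm_ofReal, abs_of_nonneg (div_nonneg (by linarith [(hc n hn).1]) hr.le),
        div_le_iff₀ hr]
      linarith [(hc n hn).2]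
    refine this.trans ?_
    rw [← mul_assoc (4 / _), ← mul_assoc]
    exact mul_le_mul_of_nonneg_right hδC (h.nonneg _)
  have hsum : ∑ n ∈ E, c n • e n = (r : 𝕜) • (g + v) := by
    rw [hg, hv, ← sum_add_distrib, smul_sum]
    refine sum_congr rfl fun n _ => ?_
    have hr' : (r : 𝕜) ≠ 0 := RCLike.ofReal_ne_zero.2 hr.ne'
    rw [smul_smul, ← add_smul, smul_smul]
    congr 1
    conv_lhs => rw [hcs n]
    simp only [hu]
    push_cast
    field_simp
    ring
  have hN : N g ≤ 2 * N (g + v) := by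
    have := h.sub_le (g + v) v
    rw [add_sub_cancel_right] at this
    linarith
  -- The phases are removed by using `(s n)⁻¹` as coefficients.
  have hone : N (∑ n ∈ E, e n) ≤ 4 / (2 ^ p - 1) * (C * N g) := by
    have := h.sum_smul_le E (fun n => s n • e n) hsub (fun n => (s n)⁻¹) zero_le_one
      fun n _ => by rw [norm_inv, hs, inv_one]
    rw [Real.one_rpow, one_mul] at this
    convert this using 3 with n
    rw [smul_smul, inv_mul_cancel₀ (norm_ne_zero_iff.1 (by rw [hs]; exact one_ne_zero)), one_smul]
  rw [hsum, h.smul, RCLike.norm_ofReal, abs_of_pos hr]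
  have hrp : 0 < r ^ p := Real.rpow_pos_of_pos hr p
  calc r ^ p * N (∑ n ∈ E, e n) ≤ r ^ p * (4 / (2 ^ p - 1) * (C * N g)) := by gcongr
    _ ≤ r ^ p * (4 / (2 ^ p - 1) * (C * (2 * N (g + v)))) := by gcongr
    _ = _ := by ring

/-- The lower estimate over greedy sets: the truncation of a vector at the height of a greedy set
is controlled by the vector. -/
theorem exists_greedy_lower_bound (h : IsPNormPow 𝕜 p N)
    (hb : ∀ n m : ℕ, e' n (e m) = if n = m then 1 else 0) {C : ℝ} (hC : 0 ≤ C)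
    (hQ : ∀ x A, IsGreedySet e' x A → N (x - proj e e' A x) ≤ C * N x) :
    ∃ K, 0 ≤ K ∧ ∀ (y : X) (D : Finset ℕ) (α : ℝ), 0 ≤ α → IsGreedySet e' y D →
      (∀ n ∈ D, α ≤ ‖e' n y‖) → α ^ p * N (∑ n ∈ D, e n) ≤ K * N y := by
  have hp := h.pos
  have h2 : 0 < (2 : ℝ) ^ p - 1 := by linarith [Real.one_lt_rpow one_lt_two h.pos]
  obtain ⟨δ, hδ, hδC⟩ : ∃ δ : ℝ, 0 < δ ∧ δ ^ p * (4 / (2 ^ p - 1) * C) ≤ 1 / 2 := by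
    -- The `+ 1` below avoids dividing by zero when `L = 0`.
    set L := 4 / ((2 : ℝ) ^ p - 1) * C with hL
    have hL0 : 0 ≤ L := by positivity
    refine ⟨(1 / (2 * (L + 1))) ^ p⁻¹, by positivity, ?_⟩
    rw [Real.rpow_inv_rpow (by positivity) hp.ne', div_mul_eq_mul_div, one_mul,
      div_le_div_iff₀ (by positivity) two_pos]
    linarith
  set q : ℝ := ((1 + δ) ^ p)⁻¹ with hq
  have hδp : 1 < (1 + δ) ^ p := Real.one_lt_rpow (by linarith) hp
  have hq0 : 0 ≤ q := by positivity
  have hq1 : q < 1 := inv_lt_one_of_one_lt₀ hδp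
  -- The constant of `sum_band_le` times the cost `C + C` of projecting onto a band, a difference of
  -- two greedy sets.
  set B : ℝ := 4 / (2 ^ p - 1) * (2 * C) * (C + C) with hB
  have hB0 : 0 ≤ B := by positivity
  refine ⟨B * (1 - q)⁻¹, mul_nonneg hB0 (inv_nonneg.2 (by linarith)), ?_⟩
  intro y D α hα hD hαD
  rcases hα.eq_or_lt with rfl | hα
  · rw [Real.zero_rpow hp.ne', zero_mul]
    exact mul_nonneg (mul_nonneg hB0 (inv_nonneg.2 (by linarith))) (h.nonneg y)
  have hband : ∀ n ∈ D, ∃ k : ℕ, α * (1 + δ) ^ k ≤ ‖e' n y‖ ∧ ‖e' n y‖ < α * (1 + δ) ^ (k + 1) := by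
    intro n hn
    obtain ⟨k, hk₁, hk₂⟩ := exists_nat_pow_near (x := ‖e' n y‖ / α) (y := 1 + δ)
      ((one_le_div hα).2 (hαD n hn)) (by linarith)
    rw [le_div_iff₀ hα] at hk₁
    rw [div_lt_iff₀ hα] at hk₂
    exact ⟨k, by linarith, by linarith⟩
  choose! j hj₁ hj₂ using hband
  have hgreedy : ∀ r : ℝ, IsGreedySet e' y {n ∈ D | r ≤ ‖e' n y‖} := by
    intro r n hn i hi
    rw [mem_filter] at hn hi
    by_cases hiD : i ∈ D
    · exact (not_le.1 fun hr => hi ⟨hiD, hr⟩).le.trans hn.2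
    · exact hD n hn.1 i hiD
  -- Band `k` has height about `α * (1 + δ) ^ k`; replacing that height by `α` gains `q ^ k`, which
  -- makes the bands summable.
  have hk : ∀ k : ℕ, α ^ p * N (∑ n ∈ D with j n = k, e n) ≤ B * N y * q ^ k := by
    intro k
    set E : Finset ℕ := {n ∈ D | j n = k} with hE
    set r : ℝ := α * (1 + δ) ^ k with hr
    have hr0 : 0 < r := by positivity
    have hEc : ∀ n ∈ E, r ≤ ‖e' n y‖ ∧ ‖e' n y‖ ≤ r * (1 + δ) := by
      intro n hn
      rw [hE, mem_filter] at hn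
      have h₁ := hj₁ n hn.1
      have h₂ := hj₂ n hn.1
      rw [hn.2] at h₁ h₂
      exact ⟨h₁, h₂.le.trans_eq (by rw [hr]; ring)⟩
    have hEd : E = {n ∈ D | r ≤ ‖e' n y‖} \ {n ∈ D | r * (1 + δ) ≤ ‖e' n y‖} := by
      ext n
      simp only [hE, mem_sdiff, mem_filter, not_and, not_le]
      constructor
      · rintro ⟨hn, rfl⟩
        refine ⟨⟨hn, hj₁ n hn⟩, fun _ => (hj₂ n hn).trans_eq (by rw [hr]; ring)⟩
      · rintro ⟨⟨hn, h₁⟩, h₂⟩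
        refine ⟨hn, ?_⟩
        have h₃ := h₂ hn
        have hδ1 : 1 < 1 + δ := by linarith
        have h₄ : α * (1 + δ) ^ (j n) < α * (1 + δ) ^ (k + 1) :=
          (hj₁ n hn).trans_lt (h₃.trans_eq (by rw [hr]; ring))
        have h₅ : α * (1 + δ) ^ k < α * (1 + δ) ^ (j n + 1) := h₁.trans_lt (hj₂ n hn)
        have h₆ := (pow_lt_pow_iff_right₀ hδ1).1 (lt_of_mul_lt_mul_left h₄ hα.le)
        have h₇ := (pow_lt_pow_iff_right₀ hδ1).1 (lt_of_mul_lt_mul_left h₅ hα.le)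
        omega
    have hsub : ({n ∈ D | r * (1 + δ) ≤ ‖e' n y‖} : Finset ℕ) ⊆ {n ∈ D | r ≤ ‖e' n y‖} :=
      monotone_filter_right D fun n _ hn => le_trans (by nlinarith) hn
    have hP : N (∑ n ∈ E, e' n y • e n) ≤ (C + C) * N y := by
      have hdiff : ∑ n ∈ E, e' n y • e n
          = (y - proj e e' {n ∈ D | r * (1 + δ) ≤ ‖e' n y‖} y)
            - (y - proj e e' {n ∈ D | r ≤ ‖e' n y‖} y) := by
        rw [hEd, sub_sub_sub_cancel_left, proj, proj, eq_sub_iff_add_eq]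
        exact sum_sdiff hsub
      rw [hdiff, add_mul]
      exact (h.sub_le _ _).trans (add_le_add (hQ _ _ (hgreedy _)) (hQ _ _ (hgreedy _)))
    have hmain := sum_band_le h hb hC hQ hδ.le hδC E (fun n => e' n y) hr0 hEc
    have hrp : r ^ p = α ^ p * (q ^ k)⁻¹ := by
      rw [hr, Real.mul_rpow hα.le (by positivity), ← Real.rpow_pow_comm (by linarith), hq, inv_pow,
        inv_inv]
    have hqk : 0 < q ^ k := by positivity
    rw [hrp] at hmain
    have h₈ : α ^ p * (q ^ k)⁻¹ * N (∑ n ∈ E, e n) ≤ B * N y := by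
      refine hmain.trans ?_
      rw [hB, mul_assoc _ (C + C)]
      gcongr
    calc α ^ p * N (∑ n ∈ E, e n) = α ^ p * (q ^ k)⁻¹ * N (∑ n ∈ E, e n) * q ^ k := by
          field_simp
      _ ≤ B * N y * q ^ k := by gcongr
  have hαp : 0 ≤ α ^ p := by positivity
  have hN : 0 ≤ B * N y := mul_nonneg hB0 (h.nonneg y)
  calc α ^ p * N (∑ n ∈ D, e n)
      ≤ α ^ p * ∑ k ∈ D.image j, N (∑ n ∈ D with j n = k, e n) := by
        rw [← sum_fiberwise_of_maps_to (fun n hn => mem_image_of_mem j hn) e]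
        exact mul_le_mul_of_nonneg_left (h.sum_le _ _) hαp
    _ ≤ ∑ k ∈ D.image j, B * N y * q ^ k := by
        rw [mul_sum]
        exact sum_le_sum fun k _ => hk k
    _ ≤ B * N y * (1 - q)⁻¹ := by
        rw [← mul_sum, ← tsum_geometric_of_lt_one hq0 hq1]
        exact mul_le_mul_of_nonneg_left ((summable_geometric_of_lt_one hq0 hq1).sum_le_tsum _
          fun k _ => by positivity) hN
    _ = B * (1 - q)⁻¹ * N y := by ring

/-- Quasi-greedy and democratic bases are almost-greedy. -/
theorem exists_almostGreedy_bound (h : IsPNormPow 𝕜 p N)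
    (hb : ∀ n m : ℕ, e' n (e m) = if n = m then 1 else 0) {C : ℝ} (hC : 0 ≤ C)
    (hQ : ∀ x A, IsGreedySet e' x A → N (x - proj e e' A x) ≤ C * N x) {Δ : ℝ} (hΔ : 0 ≤ Δ)
    (hD : ∀ A B : Finset ℕ, A.card ≤ B.card → N (∑ n ∈ A, e n) ≤ Δ * N (∑ n ∈ B, e n)) :
    ∃ K, 0 ≤ K ∧ ∀ (x : X) (A : Finset ℕ), IsGreedySet e' x A → ∀ B : Finset ℕ, B.card ≤ A.card →
      N (x - proj e e' A x) ≤ K * N (x - proj e e' B x) := by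
  have h2 : 0 < (2 : ℝ) ^ p - 1 := by linarith [Real.one_lt_rpow one_lt_two h.pos]
  obtain ⟨L, hL, hlow⟩ := exists_greedy_lower_bound h hb hC hQ
  refine ⟨C + 4 / (2 ^ p - 1) * Δ * L, by positivity, fun x A hA B hBA => ?_⟩
  set y := x - proj e e' B x with hy
  have hcoeff : ∀ n, e' n y = if n ∈ B then 0 else e' n x := by
    intro n
    rw [hy, map_sub, coeff_proj hb]
    split_ifs <;> simp
  have hcard : (B \ A).card ≤ (A \ B).card := by
    have h₁ := card_sdiff_add_card_inter A B
    have h₂ := card_sdiff_add_card_inter B A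
    rw [inter_comm] at h₂
    omega
  have hg : IsGreedySet e' y (A \ B) := by
    intro n hn i hi
    rw [mem_sdiff] at hn hi
    rw [hcoeff, hcoeff, if_neg hn.2]
    split_ifs with hiB
    · simp
    · exact hA n hn.1 i fun hiA => hi ⟨hiA, hiB⟩
  have hproj : proj e e' (A \ B) y = proj e e' (A \ B) x :=
    sum_congr rfl fun n hn => by rw [hcoeff, if_neg (mem_sdiff.1 hn).2]
  have hsplit : x - proj e e' A x = (y - proj e e' (A \ B) y) + proj e e' (B \ A) x := by
    have h₁ : proj e e' A x + proj e e' (B \ A) x = proj e e' B x + proj e e' (A \ B) x := by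
      simp only [proj]
      rw [← sum_union disjoint_sdiff, ← sum_union disjoint_sdiff, union_sdiff_self_eq_union,
        union_sdiff_self_eq_union, union_comm]
    rw [hproj, hy, sub_sub, ← h₁]
    abel
  have hrest : N (proj e e' (B \ A) x) ≤ 4 / (2 ^ p - 1) * Δ * L * N y := by
    rcases (B \ A).eq_empty_or_nonempty with hBA' | hne
    · rw [hBA', proj, sum_empty, h.zero]
      have := h.nonneg y
      positivity
    -- The largest modulus on `B \ A` separates the two sets: since `A` is greedy and `m ∉ A`, it is
    -- a lower bound on `A \ B`.
    · obtain ⟨m, hm, hmax⟩ := exists_max_image _ (fun n => ‖e' n x‖) hne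
      have hup := h.sum_smul_le (B \ A) e (M := Δ * N (∑ n ∈ A \ B, e n))
        (fun F hF => hD F _ ((card_le_card hF).trans hcard)) (fun n => e' n x)
        (norm_nonneg (e' m x)) hmax
      have hlo := hlow y (A \ B) ‖e' m x‖ (norm_nonneg _) hg fun n hn => by
        rw [mem_sdiff] at hn hm
        rw [hcoeff, if_neg hn.2]
        exact hA n hn.1 m hm.2
      calc N (proj e e' (B \ A) x)
          ≤ ‖e' m x‖ ^ p * (4 / (2 ^ p - 1) * (Δ * N (∑ n ∈ A \ B, e n))) := hup
        _ = 4 / (2 ^ p - 1) * Δ * (‖e' m x‖ ^ p * N (∑ n ∈ A \ B, e n)) := by ring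
        _ ≤ 4 / (2 ^ p - 1) * Δ * (L * N y) := by gcongr
        _ = _ := by ring
  rw [hsplit, add_mul]
  exact (h.add_le _ _).trans (add_le_add (hQ _ _ hg) hrest)

/-- The basis of an almost-greedy system is democratic. -/
theorem democratic_bound (h : IsPNormPow 𝕜 p N)
    (hb : ∀ n m : ℕ, e' n (e m) = if n = m then 1 else 0) {C : ℝ} (hC : 0 ≤ C)
    (hA : ∀ (x : X) (A : Finset ℕ), IsGreedySet e' x A → ∀ B : Finset ℕ, B.card ≤ A.card →
      N (x - proj e e' A x) ≤ C * N (x - proj e e' B x)) {A B : Finset ℕ}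
    (hAB : A.card ≤ B.card) :
    N (∑ n ∈ A, e n) ≤ (C * C + C) * N (∑ n ∈ B, e n) := by
  have hQ : ∀ x A, IsGreedySet e' x A → N (x - proj e e' A x) ≤ C * N x := fun x A hg => by
    simpa [proj] using hA x A hg ∅ (by simp)
  have hsub : ∀ F ⊆ B, N (∑ n ∈ F, e n) ≤ C * N (∑ n ∈ B, e n) := fun F hF => by
    simpa using subsum_unimodular_le hb hQ hF (fun _ => (1 : 𝕜)) fun _ => norm_one
  have hcoeff : ∀ n, e' n (∑ n ∈ A ∪ B, e n) = if n ∈ A ∪ B then 1 else 0 := fun n => by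
    simpa using coeff_sum hb (A ∪ B) (fun _ => (1 : 𝕜)) n
  have hdiff : ∀ F ⊆ A ∪ B, (∑ n ∈ A ∪ B, e n) - proj e e' F (∑ n ∈ A ∪ B, e n)
      = ∑ n ∈ (A ∪ B) \ F, e n := fun F hF => by
    have := proj_sum hb (A ∪ B) F fun _ => (1 : 𝕜)
    simp only [one_smul] at this
    rw [this, inter_eq_left.2 hF, ← sum_sdiff hF, add_sub_cancel_right]
  have hg : IsGreedySet e' (∑ n ∈ A ∪ B, e n) B := by
    intro n hn i _
    rw [hcoeff, hcoeff, if_pos (mem_union_right A hn)]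
    split_ifs <;> simp
  have h₁ := hA _ B hg A hAB
  rw [hdiff _ subset_union_left, hdiff _ subset_union_right, union_sdiff_right,
    union_sdiff_left] at h₁
  calc N (∑ n ∈ A, e n) = N (∑ n ∈ A \ B, e n + ∑ n ∈ A ∩ B, e n) := by
        rw [add_comm, sum_inter_add_sum_sdiff]
    _ ≤ C * (C * N (∑ n ∈ B, e n)) + C * N (∑ n ∈ B, e n) :=
      (h.add_le _ _).trans (add_le_add
        (h₁.trans (mul_le_mul_of_nonneg_left (hsub _ sdiff_subset) hC)) (hsub _ inter_subset_right))
    _ = _ := by ring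

end Basis

/-! ### Perturbation into `X_d`, and transfer from `p`-th powers to norms. -/

section PBanach

variable {𝕜 X : Type*} [RCLike 𝕜] [AddCommGroup X] [Module 𝕜 X] [Norm X] [UniformSpace X] {p : ℝ}
  {e : ℕ → X} {e' : ℕ → (X →L[𝕜] 𝕜)}

theorem isPNormPow_rpow_norm (hp : 0 < p) [hX : PBanachSpace 𝕜 p X] :
    IsPNormPow 𝕜 p fun x : X => ‖x‖ ^ p where
  pos := hp
  nonneg x := Real.rpow_nonneg (hX.norm_nonneg x) p
  add_le := hX.norm_add_rpow_le
  smul a x := by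
    rw [hX.norm_smul, Real.mul_rpow (norm_nonneg a) (hX.norm_nonneg x)]

/-- Every rapidly decreasing sequence is the coefficient sequence of a vector. -/
theorem exists_coeff_eq (hp : 0 < p) [hX : PBanachSpace 𝕜 p X]
    (hb : ∀ n m : ℕ, e' n (e m) = if n = m then 1 else 0) {c : ℝ} (hc : ∀ n, ‖e n‖ ≤ c)
    (a : ℕ → 𝕜) (ha : ∀ n, ‖a n‖ ≤ (1 / 4) ^ n) : ∃ v : X, ∀ n, e' n v = a n := by
  have h := isPNormPow_rpow_norm (𝕜 := 𝕜) (X := X) hp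
  have := hX.complete
  set q : ℝ := (1 / 4) ^ p with hq
  have hq0 : 0 ≤ q := by positivity
  have hq1 : q < 1 := Real.rpow_lt_one (by norm_num) (by norm_num) hp
  set S : ℕ → X := fun n => ∑ k ∈ range n, a k • e k with hS
  set T : ℕ → ℝ := fun n => ∑ k ∈ range n, q ^ k * c ^ p with hT
  have hterm : ∀ k, ‖a k • e k‖ ^ p ≤ q ^ k * c ^ p := by
    intro k
    refine (h.smul_le (ha k) (e k)).trans ?_
    rw [← Real.rpow_pow_comm (by norm_num), ← hq]
    exact mul_le_mul_of_nonneg_left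
      (Real.rpow_le_rpow (hX.norm_nonneg _) (hc k) hp.le) (by positivity)
  have hST : ∀ n m, n ≤ m → ‖S m - S n‖ ^ p ≤ T m - T n := by
    intro n m hnm
    simp only [hS, hT]
    rw [← sum_Ico_eq_sub _ hnm, ← sum_Ico_eq_sub _ hnm]
    exact (h.sum_le _ _).trans (sum_le_sum fun k _ => hterm k)
  have hTc : CauchySeq T :=
    ((summable_geometric_of_lt_one hq0 hq1).mul_right (c ^ p)).hasSum.tendsto_sum_nat.cauchySeq
  have hSc : CauchySeq S := by
    rw [hX.uniformity_basis.cauchySeq_iff]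
    intro ε hε
    obtain ⟨M, hM⟩ := Metric.cauchySeq_iff.1 hTc (ε ^ p) (by positivity)
    refine ⟨M, fun m hm n hn => ?_⟩
    have hlt : ‖S m - S n‖ ^ p < ε ^ p := by
      have hd := hM m hm n hn
      rw [Real.dist_eq] at hd
      rcases le_total n m with hnm | hnm
      · exact ((hST n m hnm).trans (le_abs_self _)).trans_lt hd
      · rw [abs_sub_comm] at hd
        have hs := h.neg (S n - S m)
        rw [neg_sub] at hs
        exact (hs.le.trans ((hST m n hnm).trans (le_abs_self _))).trans_lt hd
    exact (Real.rpow_lt_rpow_iff (hX.norm_nonneg _) hε.le hp).1 hlt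
  obtain ⟨v, hv⟩ := cauchySeq_tendsto_of_complete hSc
  refine ⟨v, fun n => ?_⟩
  have h₁ : Filter.Tendsto (fun m => e' n (S m)) Filter.atTop (nhds (e' n v)) :=
    ((e' n).continuous.tendsto v).comp hv
  refine tendsto_nhds_unique h₁ (tendsto_const_nhds.congr' ?_)
  filter_upwards [Filter.eventually_gt_atTop n] with m hm
  rw [hS, coeff_sum hb, if_pos (mem_range.2 hm)]

/-- Along a suitable direction, a vector can be perturbed by arbitrarily small amounts so that its
coefficients get distinct moduli and a given greedy set stays greedy. -/
theorem exists_perturbation (hp : 0 < p) [PBanachSpace 𝕜 p X]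
    (hb : ∀ n m : ℕ, e' n (e m) = if n = m then 1 else 0) {c : ℝ} (hc : ∀ n, ‖e n‖ ≤ c)
    (x : X) {A : Finset ℕ} (hA : IsGreedySet e' x A) :
    ∃ v : X, ∀ ε : ℝ, 0 < ε → ∃ t : ℝ, 0 < t ∧ t < ε ∧
      x + (t : 𝕜) • v ∈ distinctModuli e' ∧ IsGreedySet e' (x + (t : 𝕜) • v) A := by
  choose s hs hxs using fun n => exists_norm_one_eq_norm_mul (e' n x)
  obtain ⟨v₀, hv₀⟩ := exists_coeff_eq hp hb hc (fun n => (((1 / 4) ^ n : ℝ) : 𝕜) * s n) fun n => by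
    rw [norm_mul, hs, mul_one, RCLike.norm_ofReal, abs_of_nonneg (by positivity)]
  -- The weights lie in `(2, 3]` on `A` and in `(0, 1]` off it, so they favour `A` and stay
  -- distinct.
  set w : ℕ → ℝ := fun n => (if n ∈ A then 2 else 0) + (1 / 4) ^ n with hw
  have hpow1 : ∀ n : ℕ, (1 / 4 : ℝ) ^ n ≤ 1 := fun n => pow_le_one₀ (by norm_num) (by norm_num)
  have hpow0 : ∀ n : ℕ, 0 < (1 / 4 : ℝ) ^ n := fun n => by positivity
  have hw0 : ∀ n, 0 ≤ w n := fun n => by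
    have := hpow0 n
    simp only [hw]; split_ifs <;> linarith
  have hwA : ∀ n ∈ A, ∀ j ∉ A, w j ≤ w n := fun n hn j hj => by
    have := hpow0 n
    have := hpow1 j
    simp only [hw, if_pos hn, if_neg hj]
    linarith
  have hwinj : Function.Injective w := by
    intro n j hnj
    refine pow_right_injective₀ (a := (1 / 4 : ℝ)) (by norm_num) (by norm_num) ?_
    have h₁ := hpow0 n
    have h₂ := hpow1 n
    have h₃ := hpow0 j
    have h₄ := hpow1 j
    simp only [hw] at hnj
    show (1 / 4 : ℝ) ^ n = (1 / 4) ^ j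
    split_ifs at hnj <;> linarith
  set v := v₀ + ∑ n ∈ A, (2 * s n) • e n with hv
  have hcoeff : ∀ (t : ℝ) (n : ℕ), 0 ≤ t → ‖e' n (x + (t : 𝕜) • v)‖ = ‖e' n x‖ + t * w n := by
    intro t n ht
    have : e' n (x + (t : 𝕜) • v) = ((‖e' n x‖ + t * w n : ℝ) : 𝕜) * s n := by
      rw [map_add, map_smul, hv, map_add, hv₀, coeff_sum hb, hxs n]
      simp only [norm_mul, RCLike.norm_ofReal, abs_norm, hs, mul_one, hw]
      split_ifs <;> (push_cast; rw [smul_eq_mul]; ring)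
    rw [this, norm_mul, hs, mul_one, RCLike.norm_ofReal, abs_of_nonneg]
    have := hw0 n
    positivity
  refine ⟨v, fun ε hε => ?_⟩
  set bad : Set ℝ := ⋃ (n : ℕ) (j : ℕ) (_ : n ≠ j), {t | ‖e' n x‖ + t * w n = ‖e' j x‖ + t * w j}
    with hbad
  -- For each pair `n ≠ j` the equation is affine in `t` with slope `w n - w j ≠ 0`, so it has at
  -- most one solution.
  have hcount : bad.Countable := by
    refine Set.countable_iUnion fun n => Set.countable_iUnion fun j => Set.countable_iUnion
      fun hnj => Set.Subsingleton.countable fun t ht u hu => ?_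
    simp only [Set.mem_ofPred_eq] at ht hu
    have hne : w n - w j ≠ 0 := sub_ne_zero.2 fun hh => hnj (hwinj hh)
    refine mul_right_cancel₀ hne ?_
    linarith
  obtain ⟨t, htbad, ht₀, htε⟩ := (hcount.dense_compl ℝ).exists_between hε
  refine ⟨t, ht₀, htε, fun n j hnj heq => htbad ?_, fun n hn j hj => ?_⟩
  · rw [hcoeff t n ht₀.le, hcoeff t j ht₀.le] at heq
    exact Set.mem_iUnion.2 ⟨n, Set.mem_iUnion.2 ⟨j, Set.mem_iUnion.2 ⟨hnj, heq⟩⟩⟩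
  · rw [hcoeff t n ht₀.le, hcoeff t j ht₀.le]
    exact add_le_add (hA n hn j hj) (mul_le_mul_of_nonneg_left (hwA n hn j hj) ht₀.le)

theorem rpow_le_mul_rpow {a b C : ℝ} (hp : 0 < p) (ha : 0 ≤ a) (hb : 0 ≤ b) (hC : 0 ≤ C)
    (h : a ≤ C * b) : a ^ p ≤ C ^ p * b ^ p := by
  rw [← Real.mul_rpow hC hb]
  exact Real.rpow_le_rpow ha h hp.le

theorem le_mul_of_rpow_le {a b C : ℝ} (hp : 0 < p) (ha : 0 ≤ a) (hb : 0 ≤ b) (hC : 0 ≤ C)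
    (h : a ^ p ≤ C * b ^ p) : a ≤ C ^ p⁻¹ * b := by
  rw [← Real.rpow_le_rpow_iff ha (by positivity) hp, Real.mul_rpow (by positivity) hb,
    Real.rpow_inv_rpow hC hp.ne']
  exact h

/-- The almost-greedy inequality in terms of `p`-th powers of norms. -/
theorem almostGreedyOn_iff (hp : 0 < p) [hX : PBanachSpace 𝕜 p X] (D : Set X) :
    AlmostGreedyOn e e' D ↔ ∃ C : ℝ, 0 < C ∧ ∀ x ∈ D, ∀ A : Finset ℕ, IsGreedySet e' x A →
      ∀ B : Finset ℕ, B.card ≤ A.card →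
        ‖x - proj e e' A x‖ ^ p ≤ C * ‖x - proj e e' B x‖ ^ p := by
  constructor
  · rintro ⟨C, hC, hAG⟩
    refine ⟨C ^ p, by positivity, fun x hx A hA B hB => ?_⟩
    refine rpow_le_mul_rpow hp (hX.norm_nonneg _) (hX.norm_nonneg _) hC.le
      ((hAG x hx A hA).trans (mul_le_mul_of_nonneg_left ?_ hC.le))
    refine ciInf_le (f := fun B : {B : Finset ℕ // B.card ≤ A.card} => ‖x - proj e e' B x‖)
      ⟨0, ?_⟩ ⟨B, hB⟩
    rintro _ ⟨B, rfl⟩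
    exact hX.norm_nonneg _
  · rintro ⟨C, hC, hAG⟩
    refine ⟨C ^ p⁻¹, by positivity, fun x hx A hA => ?_⟩
    have : Nonempty {B : Finset ℕ // B.card ≤ A.card} := ⟨⟨A, le_rfl⟩⟩
    rw [Real.mul_iInf_of_nonneg (by positivity)]
    exact le_ciInf fun B => le_mul_of_rpow_le hp (hX.norm_nonneg _) (hX.norm_nonneg _) hC.le
      (hAG x hx A hA B B.2)

/-- Being almost-greedy may be tested on vectors whose coefficients have distinct moduli. -/
theorem AlmostGreedyOn.almostGreedy (hp : 0 < p) [hX : PBanachSpace 𝕜 p X]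
    (hb : ∀ n m : ℕ, e' n (e m) = if n = m then 1 else 0) {c : ℝ} (hc : ∀ n, ‖e n‖ ≤ c)
    (hAG : AlmostGreedyOn e e' (distinctModuli e')) : AlmostGreedy e e' := by
  have h := isPNormPow_rpow_norm (𝕜 := 𝕜) (X := X) hp
  obtain ⟨C, hC, hAG⟩ := (almostGreedyOn_iff hp _).1 hAG
  refine (almostGreedyOn_iff hp _).2 ⟨C, hC, fun x _ A hA B hB => ?_⟩
  obtain ⟨v, hv⟩ := exists_perturbation hp hb hc x hA
  set R : ℝ := ‖v - proj e e' A v‖ ^ p + C * ‖v - proj e e' B v‖ ^ p with hR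
  have hR0 : 0 ≤ R := add_nonneg (h.nonneg _) (mul_nonneg hC.le (h.nonneg _))
  refine le_of_forall_pos_le_add fun η hη => ?_
  -- The perturbation contributes `t ^ p * R` in all, made at most `η`; the `+ 1` covers `R = 0`.
  obtain ⟨t, ht₀, htε, htd, htg⟩ := hv ((η / (R + 1)) ^ p⁻¹) (by positivity)
  have htp : t ^ p * R ≤ η := by
    have : t ^ p ≤ η / (R + 1) := by
      have := Real.rpow_le_rpow ht₀.le htε.le hp.le
      rwa [Real.rpow_inv_rpow (by positivity) hp.ne'] at this
    calc t ^ p * R ≤ η / (R + 1) * (R + 1) := by gcongr; linarith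
      _ = η := by field_simp
  have hsplit : ∀ F : Finset ℕ, x + (t : 𝕜) • v - proj e e' F (x + (t : 𝕜) • v)
      = (x - proj e e' F x) + (t : 𝕜) • (v - proj e e' F v) := fun F => by
    rw [proj_add, proj_smul, smul_sub]
    abel
  have htsmul : ∀ z : X, ‖(t : 𝕜) • z‖ ^ p = t ^ p * ‖z‖ ^ p := fun z => by
    have := h.smul (t : 𝕜) z
    rwa [RCLike.norm_ofReal, abs_of_pos ht₀] at this
  have h₁ := hAG _ htd A htg B hB
  rw [hsplit, hsplit] at h₁
  have h₂ := h.sub_le (x - proj e e' A x + (t : 𝕜) • (v - proj e e' A v))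
    ((t : 𝕜) • (v - proj e e' A v))
  have h₃ := h.add_le (x - proj e e' B x) ((t : 𝕜) • (v - proj e e' B v))
  simp only [add_sub_cancel_right, htsmul] at h₂ h₃
  calc ‖x - proj e e' A x‖ ^ p
      ≤ C * (‖x - proj e e' B x‖ ^ p + t ^ p * ‖v - proj e e' B v‖ ^ p)
        + t ^ p * ‖v - proj e e' A v‖ ^ p :=
        h₂.trans (add_le_add (h₁.trans (mul_le_mul_of_nonneg_left h₃ hC.le)) le_rfl)
    _ = C * ‖x - proj e e' B x‖ ^ p + t ^ p * R := by rw [hR]; ring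
    _ ≤ C * ‖x - proj e e' B x‖ ^ p + η := by gcongr

theorem AlmostGreedy.quasiGreedy_and_democratic (hp : 0 < p) [hX : PBanachSpace 𝕜 p X]
    (hb : ∀ n m : ℕ, e' n (e m) = if n = m then 1 else 0) (hAG : AlmostGreedy e e') :
    QuasiGreedy e e' ∧ Democratic e := by
  have h := isPNormPow_rpow_norm (𝕜 := 𝕜) (X := X) hp
  obtain ⟨C, hC, hAG⟩ := (almostGreedyOn_iff hp _).1 hAG
  constructor
  · refine ⟨C ^ p⁻¹, by positivity, fun x A hA => ?_⟩
    refine le_mul_of_rpow_le hp (hX.norm_nonneg _) (hX.norm_nonneg _) hC.le ?_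
    simpa [proj] using hAG x trivial A hA ∅ (by simp)
  · refine ⟨(C * C + C) ^ p⁻¹, by positivity, fun A B hAB => ?_⟩
    exact le_mul_of_rpow_le hp (hX.norm_nonneg _) (hX.norm_nonneg _) (by positivity)
      (democratic_bound h hb hC.le (fun x A hA => hAG x trivial A hA) hAB)

theorem QuasiGreedy.almostGreedy (hp : 0 < p) [hX : PBanachSpace 𝕜 p X]
    (hb : ∀ n m : ℕ, e' n (e m) = if n = m then 1 else 0) (hQ : QuasiGreedy e e')
    (hD : Democratic e) : AlmostGreedy e e' := by
  have h := isPNormPow_rpow_norm (𝕜 := 𝕜) (X := X) hp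
  obtain ⟨C, hC, hQ⟩ := hQ
  obtain ⟨Δ, hΔ, hD⟩ := hD
  obtain ⟨K, hK, hKbound⟩ := exists_almostGreedy_bound h hb (by positivity : 0 ≤ C ^ p)
    (fun x A hA => rpow_le_mul_rpow hp (hX.norm_nonneg _) (hX.norm_nonneg _) hC.le (hQ x A hA))
    (by positivity : 0 ≤ Δ ^ p)
    (fun A B hAB => rpow_le_mul_rpow hp (hX.norm_nonneg _) (hX.norm_nonneg _) hΔ.le (hD A B hAB))
  -- `K` is only known to be nonnegative, while the constant must be positive.
  refine (almostGreedyOn_iff hp _).2 ⟨K + 1, by positivity, fun x _ A hA B hB => ?_⟩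
  refine (hKbound x A hA B hB).trans (mul_le_mul_of_nonneg_right (by linarith) (h.nonneg _))

end PBanach

end GreedyBasis

theorem mainTheorem3 {𝕜 X : Type*} [RCLike 𝕜] [AddCommGroup X] [Module 𝕜 X] [Norm X]
    [UniformSpace X] (p : ℝ) (hp₀ : 0 < p) (hp₁ : p ≤ 1) [GreedyBasis.PBanachSpace 𝕜 p X]
    (e : ℕ → X) (e' : ℕ → (X →L[𝕜] 𝕜)) (he : GreedyBasis.IsMarkushevichBasis e e') :
    List.TFAE
      [GreedyBasis.AlmostGreedy e e',
       GreedyBasis.AlmostGreedyOn e e' (GreedyBasis.distinctModuli e'),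
       GreedyBasis.QuasiGreedy e e' ∧ GreedyBasis.Democratic e] := by
  obtain ⟨c₁, c₂, -, hc⟩ := he.semi_normalized
  have hc₂ : ∀ n, ‖e n‖ ≤ c₂ := fun n => (le_max_left _ _).trans (hc n).2
  tfae_have 1 → 2 := fun ⟨C, hC, h⟩ => ⟨C, hC, fun x _ => h x trivial⟩
  tfae_have 2 → 1 := fun h => h.almostGreedy hp₀ he.biorthogonal hc₂
  tfae_have 1 → 3 := fun h => h.quasiGreedy_and_democratic hp₀ he.biorthogonal
  tfae_have 3 → 1 := fun h => h.1.almostGreedy hp₀ he.biorthogonal h.2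
  tfae_finish
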